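/- Let $p$ be a prime with $p\equiv 3\pmod 4$, let $r$ be a positive even integer, put $q=p^r$, let $\mathbb F_q$ be the field with $q$ elements and let $\omega$ be any primitive root (generator of the multiplicative group) of $\mathbb F_q$. The Paley graph on $q$ vertices has vertex set $\mathbb F_q$, with distinct $x,y$ adjacent if and only if $x-y$ is a nonzero square. The Peisert graph on $q$ vertices has vertex set $\mathbb F_q$, with distinct $x,y$ adjacent if and only if $x-y=\omega^j$ for some integer $j\ge 0$ with $j\equiv 0$ or $1\pmod 4$. Both relations are symmetric, since $q \equiv 1 \pmod 8$. Then: 1. Both graphs are strongly regular with the same parameters $\left(q,\tfrac{q-1}{2},\tfrac{q-5}{4},\tfrac{q-1}{4}\right)$, and they are cospectral, i.e. their adjacency matrices have the same eigenvalues, counted with multiplicity. 2. If $q>9$, the two graphs are not isomorphic. Consequently the Paley and Peisert graphs form an infinite family of non-isomorphic cospectral pairs: there are infinitely many $q$ of the above form for which the Paley graph and the Peisert graph on $q$ vertices are cospectral and not isomorphic. -/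

import Mathlib

/-- The Paley graph on a finite field `F`: the edges are the unordered pairs `{x, y}` of distinct
elements whose difference is a quadratic residue, i.e. a nonzero square.
(`fromRel` discards loops and forgets the order of `x` and `y`; if `|F| ≡ 1 (mod 4)`, then `-1` is
a square and the order does not matter.) -/
def paleyGraph (F : Type*) [Field F] : SimpleGraph F :=
  SimpleGraph.fromRel fun x y => IsSquare (x - y)

/-- The Peisert graph on a finite field, built from a primitive root `ω`: the edges are the
unordered pairs `{x, y}` with `x - y = ω ^ j` for some `j` congruent to `0` or `1` modulo `4`.
(If `|F| ≡ 1 (mod 8)`, then `-1 = ω ^ ((|F| - 1) / 2)` is a fourth power, so the order of `x` and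
`y` does not matter.) -/
def peisertGraph {F : Type*} [Field F] (ω : F) : SimpleGraph F :=
  SimpleGraph.fromRel fun x y => ∃ j : ℕ, (j % 4 = 0 ∨ j % 4 = 1) ∧ x - y = ω ^ j

open Classical in
/-- The spectrum of a finite graph: the multiset of eigenvalues of its adjacency matrix, a real
symmetric matrix, counted with multiplicity. -/
noncomputable def graphSpectrum {V : Type*} [Fintype V] (G : SimpleGraph V) : Multiset ℝ :=
  (G.adjMatrix ℝ).charpoly.roots

/-- Two finite graphs are cospectral if they have the same spectrum. -/
def Cospectral {V W : Type*} [Fintype V] [Fintype W] (G : SimpleGraph V) (H : SimpleGraph W) :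
    Prop :=
  graphSpectrum G = graphSpectrum H

/-!
Both graphs are Cayley graphs on the additive group of `F`, `|F| = q = p ^ r`, and are described by
sign functions `ε : F → {0, 1, -1}`: the quadratic character for the Paley graph and `peisertSign`
for the Peisert graph.

*Strong regularity and spectrum.* For each graph there are additive bijections of `F`, under which
`ε` is invariant up to a global sign, that act transitively on the nonzero elements: multiplications
for the Paley graph; multiplication by `ω ^ 2` and `z ↦ ω * z ^ p` for the Peisert graph. So the
autocorrelation `∑ z, ε z * ε (z + a)` is the same for all `a ≠ 0`, hence equal to `-1`, which gives
the parameters (`isSRGWith_of_sign`). The parameters determine the traces of all powers of the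
adjacency matrix, hence its spectrum (`SimpleGraph.IsSRGWith.cospectral`).

*Non-isomorphism.* Put `m = (q - 1) / 2` and `k = (q - 1) / 4`. Inside `F` the quadratic character is
`z ^ m` and the Peisert sign is `α * z ^ k + β * z ^ (3 * k)` with `α ≠ 0`, so an isomorphism `g` from
the Paley graph to the Peisert graph satisfies
`(x - y) ^ m = α * (g x - g y) ^ k + β * (g x - g y) ^ (3 * k)`.
Call the degree of the polynomial of degree less than `q` that represents a function its reduced
degree. If `k.choose j ≠ 0` and `(3 * k).choose (k - j) = 0` in `F`, a comparison of coefficients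
shows that `g ^ j` has reduced degree at most `m` (`natDegree_reducedPoly_pow_le_of_kernel`). By
Lucas' theorem these exponents `j` can be read off from the base-`p` digits of `k` and `3 * k`, which
alternate between `3 * d - 1` and `d - 1`, where `p = 4 * d - 1`, while all digits of `m` are
`2 * d - 1`. The same applies to all Frobenius twists of `g`, one of which, `G`, has reduced degree
`D ≥ p ^ (r - 1)` (`exists_le_natDegree_reducedPoly_pow`). If `r ≥ 4`, all `j ≤ 2 * d` are
admissible, but `l * D` lies in `(m, 2 * m]` for some `l ≤ 2 * d`, a contradiction. If `r = 2`, only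
`j ≤ 2 * d - 1` and, for `p > 3`, `j = 2 * d - 1 + p` are used; they force `G ^ p` to be affine, and
then `z ^ m` would be a polynomial with a nonzero coefficient at `z ^ k` (`not_twoTermKernel`).
-/

/-! ### Strongly regular graphs from sign functions -/

section Sign

variable {F : Type*} [Field F] [Fintype F] [DecidableEq F]

/-- If the autocorrelations of a balanced sign function `ε` agree at all nonzero shifts, they are
all `-1`, as all autocorrelations add up to `(∑ z, ε z) ^ 2 = 0`. -/
theorem sum_mul_shift_eq_neg_one {ε : F → ℤ} (h0 : ε 0 = 0) (h1 : ∀ z ≠ 0, ε z = 1 ∨ ε z = -1)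
    (hsum : ∑ z, ε z = 0)
    (hT : ∀ a ≠ 0, ∑ z, ε z * ε (z + a) = ∑ z, ε z * ε (z + 1)) {a : F} (ha : a ≠ 0) :
    ∑ z, ε z * ε (z + a) = -1 := by
  have hall : ∑ a, ∑ z, ε z * ε (z + a) = 0 := by
    rw [Finset.sum_comm]
    refine Finset.sum_eq_zero fun z _ => ?_
    rw [← Finset.mul_sum, Fintype.sum_equiv (Equiv.addLeft z) (fun a => ε (z + a)) ε
      (fun _ => rfl), hsum, mul_zero]
  have hsq : ∑ z, ε z * ε (z + 0) = Fintype.card F - 1 := by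
    rw [← Finset.add_sum_erase _ _ (Finset.mem_univ (0 : F))]
    rw [Finset.sum_congr rfl (g := fun _ => (1 : ℤ))]
    · have : 0 < Fintype.card F := Fintype.card_pos
      simp [h0, Finset.card_erase_of_mem, Finset.card_univ, Nat.cast_sub (Nat.succ_le_of_lt this)]
    · intro z hz
      rcases h1 z (Finset.ne_of_mem_erase hz) with h | h <;> simp [h]
  have hne : ∑ a ∈ Finset.univ.erase (0 : F), ∑ z, ε z * ε (z + a) =
      (Fintype.card F - 1) * ∑ z, ε z * ε (z + 1) := by
    rw [Finset.sum_congr rfl fun a ha => hT a (Finset.ne_of_mem_erase ha)]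
    have : 0 < Fintype.card F := Fintype.card_pos
    simp [Finset.card_erase_of_mem, Finset.card_univ, Nat.cast_sub (Nat.succ_le_of_lt this)]
  rw [← Finset.add_sum_erase _ _ (Finset.mem_univ (0 : F)), hsq, hne] at hall
  have hc : (Fintype.card F : ℤ) - 1 ≠ 0 := by
    have : 1 < Fintype.card F := Fintype.one_lt_card
    omega
  rw [hT a ha]
  have : ((Fintype.card F : ℤ) - 1) * (∑ z, ε z * ε (z + 1) + 1) = 0 := by linarith
  rcases mul_eq_zero.mp this with h | h
  · exact absurd h hc
  · linarith

/-- A Cayley graph of the additive group whose sign function is balanced and has constant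
autocorrelation at the nonzero shifts is strongly regular with the Paley parameters. -/
theorem isSRGWith_of_sign {G : SimpleGraph F} [DecidableRel G.Adj] {ε : F → ℤ} (h0 : ε 0 = 0)
    (h1 : ∀ z ≠ 0, ε z = 1 ∨ ε z = -1) (hadj : ∀ x y, G.Adj x y ↔ ε (x - y) = 1)
    (hsum : ∑ z, ε z = 0)
    (hT : ∀ a ≠ 0, ∑ z, ε z * ε (z + a) = ∑ z, ε z * ε (z + 1)) :
    G.IsSRGWith (Fintype.card F) ((Fintype.card F - 1) / 2) ((Fintype.card F - 5) / 4)
      ((Fintype.card F - 1) / 4) := by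
  have hneg : ∀ z, ε (-z) = ε z := by
    intro z
    rcases eq_or_ne z 0 with rfl | hz
    · simp
    have h := hadj 0 z
    rw [G.adj_comm, hadj, sub_zero, zero_sub] at h
    rcases h1 z hz with h2 | h2 <;> rcases h1 (-z) (neg_ne_zero.mpr hz) with h3 | h3 <;>
      simp_all
  -- `ε z + 1 - [z = 0]` is twice the indicator function of the neighbours of `0`.
  have hind : ∀ x y, (2 * if G.Adj x y then 1 else 0 : ℤ) =
      ε (x - y) + 1 - if x = y then 1 else 0 := by
    intro x y
    simp only [hadj]
    rcases eq_or_ne x y with rfl | hxy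
    · simp [h0]
    · rcases h1 (x - y) (sub_ne_zero.mpr hxy) with h | h <;> simp [h, hxy]
  have htrans : ∀ x, ∑ z, ε (x - z) = 0 := fun x => by
    rw [← hsum]; exact Fintype.sum_equiv (Equiv.subLeft x) _ _ fun _ => rfl
  have hdeg : ∀ x, 2 * (G.degree x : ℤ) = Fintype.card F - 1 := by
    intro x
    rw [← G.card_neighborFinset_eq_degree, G.neighborFinset_eq_filter, Finset.card_filter]
    push_cast
    rw [Finset.mul_sum, Finset.sum_congr rfl fun y _ => hind x y]
    simp [Finset.sum_add_distrib, Finset.sum_sub_distrib, htrans, Finset.card_univ]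
  have hcommon : ∀ x y, x ≠ y → 4 * (Fintype.card (G.commonNeighbors x y) : ℤ) =
      Fintype.card F - 3 - 2 * ε (x - y) := by
    intro x y hxy
    have hcard : Fintype.card (G.commonNeighbors x y) =
        (Finset.univ.filter fun z => G.Adj x z ∧ G.Adj y z).card := by
      rw [Fintype.card_subtype]
      congr 1
    have hconv : ∑ z, ε (x - z) * ε (y - z) = -1 := by
      rw [← sum_mul_shift_eq_neg_one h0 h1 hsum hT (sub_ne_zero.mpr hxy.symm)]
      refine Fintype.sum_equiv (Equiv.subLeft x) _ _ fun z => ?_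
      simp
    rw [hcard, Finset.card_filter]
    push_cast
    have : ∀ z, (4 * (if G.Adj x z ∧ G.Adj y z then 1 else 0) : ℤ) =
        (ε (x - z) + 1 - if x = z then 1 else 0) * (ε (y - z) + 1 - if y = z then 1 else 0) := by
      intro z
      rw [← hind, ← hind]
      by_cases ha : G.Adj x z <;> by_cases hb : G.Adj y z <;> simp [ha, hb]
    rw [Finset.mul_sum, Finset.sum_congr rfl fun z _ => this z]
    have hexp : ∀ z, (ε (x - z) + 1 - if x = z then 1 else 0) *
        (ε (y - z) + 1 - if y = z then 1 else 0) =
        ε (x - z) * ε (y - z) + ε (x - z) + ε (y - z) + 1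
          - (if x = z then ε (y - z) + 1 else 0) - (if y = z then ε (x - z) + 1 else 0) := by
      intro z
      by_cases ha : x = z <;> by_cases hb : y = z
      · exact absurd (ha.trans hb.symm) hxy
      all_goals simp [ha, hb]; try ring
    rw [Finset.sum_congr rfl fun z _ => hexp z]
    have hyx : ε (y - x) = ε (x - y) := by rw [← hneg, neg_sub]
    simp [Finset.sum_add_distrib, Finset.sum_sub_distrib, htrans, hconv, hyx, Finset.card_univ]
    ring
  refine ⟨rfl, fun x => ?_, fun x y hxy => ?_, fun x y hne hxy => ?_⟩
  · have := hdeg x; omega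
  · have := hcommon x y hxy.ne
    rw [(hadj x y).mp hxy] at this
    omega
  · have := hcommon x y hne
    rcases h1 (x - y) (sub_ne_zero.mpr hne) with h | h
    · exact absurd ((hadj x y).mpr h) hxy
    rw [h] at this
    omega

end Sign

/-! ### Cospectrality of strongly regular graphs -/

section Cospectral

open Polynomial

theorem Matrix.IsHermitian.trace_pow_eq_sum_roots_charpoly {n : Type*} [Fintype n] [DecidableEq n]
    {A : Matrix n n ℝ} (hA : A.IsHermitian) (k : ℕ) :
    (A ^ k).trace = (A.charpoly.roots.map fun x => x ^ k).sum := by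
  rw [hA.roots_charpoly_eq_eigenvalues]
  conv_lhs => rw [hA.spectral_theorem, ← map_pow, Matrix.diagonal_pow,
    Unitary.conjStarAlgAut_apply, Matrix.trace_mul_cycle]
  simp [Matrix.trace]

/-- A finite multiset of elements of a field of characteristic zero is determined by its power
sums. -/
theorem Multiset.eq_of_sum_pow_eq {K : Type*} [Field K] [CharZero K] {M N : Multiset K}
    (h : ∀ k : ℕ, (M.map fun x => x ^ k).sum = (N.map fun x => x ^ k).sum) : M = N := by
  classical
  have hP : ∀ P : K[X], (M.map fun x => P.eval x).sum = (N.map fun x => P.eval x).sum := by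
    intro P
    induction P using Polynomial.induction_on' with
    | add P Q hP hQ => simp [Multiset.sum_map_add, hP, hQ]
    | monomial k a => simp [Multiset.sum_map_mul_left, h]
  ext x
  -- A polynomial that vanishes at all elements of `M` and `N` except `x`.
  set P : K[X] := ∏ y ∈ (M + N).toFinset.erase x, (X - C y) with hPdef
  have hPx : P.eval x ≠ 0 := by
    rw [hPdef, eval_prod, Finset.prod_ne_zero_iff]
    intro y hy
    simpa [sub_eq_zero] using (Finset.ne_of_mem_erase hy).symm
  have hPy : ∀ y ∈ M + N, P.eval y = if x = y then P.eval x else 0 := by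
    intro y hy
    split_ifs with hxy
    · rw [hxy]
    · rw [hPdef, eval_prod, Finset.prod_eq_zero (i := y)]
      · exact Finset.mem_erase.mpr ⟨Ne.symm hxy, by simpa using hy⟩
      · simp
  have hcount : ∀ L ≤ M + N, (L.map fun y => P.eval y).sum = L.count x * P.eval x := by
    intro L hL
    rw [Multiset.map_congr rfl fun y hy => hPy y (Multiset.mem_of_le hL hy)]
    clear hL
    induction L using Multiset.induction_on with
    | empty => simp
    | cons a s ih =>
      rw [Multiset.map_cons, Multiset.sum_cons, ih, Multiset.count_cons]
      split_ifs <;> push_cast <;> ring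
  have := hP P
  rw [hcount M (Multiset.le_add_right _ _), hcount N (Multiset.le_add_left _ _)] at this
  exact_mod_cast mul_right_cancel₀ hPx this

theorem SimpleGraph.IsSRGWith.adjMatrix_pow_add_two {V : Type*} [Fintype V] [DecidableEq V]
    {G : SimpleGraph V} [DecidableRel G.Adj] {n k l μ : ℕ} (h : G.IsSRGWith n k l μ) (i : ℕ) :
    G.adjMatrix ℝ ^ (i + 2) = ((k : ℝ) - μ) • G.adjMatrix ℝ ^ i +
      ((l : ℝ) - μ) • G.adjMatrix ℝ ^ (i + 1) +
        ((μ : ℝ) * k ^ i) • Matrix.of fun _ _ => (1 : ℝ) := by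
  have hJ : ∀ j : ℕ, G.adjMatrix ℝ ^ j * (Matrix.of fun _ _ => (1 : ℝ)) =
      ((k : ℝ) ^ j) • Matrix.of fun _ _ => (1 : ℝ) := by
    intro j
    induction j with
    | zero => simp
    | succ j ih =>
      rw [pow_succ', mul_assoc, ih, Matrix.mul_smul]
      ext v w
      simp [h.regular.degree_eq, pow_succ]
  have hcompl : Gᶜ.adjMatrix ℝ = (Matrix.of fun _ _ => (1 : ℝ)) - 1 - G.adjMatrix ℝ := by
    ext v w
    rcases eq_or_ne v w with rfl | hvw
    · simp
    · by_cases hadj : G.Adj v w <;> simp [hvw, hadj]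
  rw [pow_add, h.matrix_eq (α := ℝ), hcompl, mul_smul, ← hJ, pow_succ]
  simp only [← Nat.cast_smul_eq_nsmul ℝ]
  simp only [mul_add, mul_sub, Matrix.mul_smul, mul_one, smul_sub, sub_smul]
  abel

/-- The parameters of a strongly regular graph determine the numbers of closed walks, hence the
power sums of the eigenvalues, hence the spectrum. -/
theorem SimpleGraph.IsSRGWith.cospectral {V W : Type*} [Fintype V] [Fintype W] [DecidableEq V]
    [DecidableEq W] {G : SimpleGraph V} {H : SimpleGraph W} [DecidableRel G.Adj]
    [DecidableRel H.Adj] {n k l μ : ℕ} (hG : G.IsSRGWith n k l μ) (hH : H.IsSRGWith n k l μ) :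
    Cospectral G H := by
  have htr : ∀ i, (G.adjMatrix ℝ ^ i).trace = (H.adjMatrix ℝ ^ i).trace := by
    intro i
    induction i using Nat.twoStepInduction with
    | zero => simp [hG.card, hH.card]
    | one => simp
    | more i h1 h2 =>
      rw [hG.adjMatrix_pow_add_two, hH.adjMatrix_pow_add_two]
      simp only [Matrix.trace_add, Matrix.trace_smul, h1, h2]
      simp [Matrix.trace, hG.card, hH.card]
  unfold Cospectral graphSpectrum
  refine Multiset.eq_of_sum_pow_eq fun i => ?_
  have hh := htr i
  rw [Matrix.IsHermitian.trace_pow_eq_sum_roots_charpoly (by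
      rw [Matrix.IsHermitian, Matrix.conjTranspose_eq_transpose_of_trivial]
      exact SimpleGraph.isSymm_adjMatrix _),
    Matrix.IsHermitian.trace_pow_eq_sum_roots_charpoly (by
      rw [Matrix.IsHermitian, Matrix.conjTranspose_eq_transpose_of_trivial]
      exact SimpleGraph.isSymm_adjMatrix _)] at hh
  convert hh <;> rfl

end Cospectral

/-! ### Reduced polynomials of functions on a finite field -/

section ReducedPolynomial

open Polynomial

variable {F : Type*} [Field F] [Fintype F]

open Classical in
/-- The reduced polynomial of a function `φ` on a finite field `F`: the unique polynomial of degree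
less than `|F|` that takes the values of `φ`. -/
noncomputable def reducedPoly (φ : F → F) : F[X] :=
  Lagrange.interpolate Finset.univ id φ

theorem eval_reducedPoly (φ : F → F) (x : F) : (reducedPoly φ).eval x = φ x := by
  classical
  have := Lagrange.eval_interpolate_at_node (s := Finset.univ) (v := id) φ
    (Function.injective_id.injOn) (Finset.mem_univ x)
  simpa [reducedPoly] using this

theorem natDegree_reducedPoly_lt (φ : F → F) : (reducedPoly φ).natDegree < Fintype.card F := by
  classical
  have h := Lagrange.degree_interpolate_lt (s := Finset.univ) (v := id) φ
    (Function.injective_id.injOn)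
  rcases eq_or_ne (reducedPoly φ) 0 with h0 | h0
  · rw [h0]; simpa using Fintype.card_pos
  · rw [natDegree_lt_iff_degree_lt h0]
    exact h

theorem eq_of_natDegree_lt_card_of_eval_eq {P Q : F[X]} (hP : P.natDegree < Fintype.card F)
    (hQ : Q.natDegree < Fintype.card F) (h : ∀ x, P.eval x = Q.eval x) : P = Q := by
  refine Polynomial.eq_of_natDegree_lt_card_of_eval_eq P Q Function.injective_id
    (fun x => h x) (max_lt hP hQ)

theorem reducedPoly_eq {φ : F → F} {P : F[X]} (hP : P.natDegree < Fintype.card F)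
    (h : ∀ x, P.eval x = φ x) : reducedPoly φ = P :=
  eq_of_natDegree_lt_card_of_eval_eq (natDegree_reducedPoly_lt φ) hP fun x => by
    rw [eval_reducedPoly, h]

theorem natDegree_reducedPoly_mul {φ ψ : F → F} (hφ : reducedPoly φ ≠ 0) (hψ : reducedPoly ψ ≠ 0)
    (h : (reducedPoly φ).natDegree + (reducedPoly ψ).natDegree < Fintype.card F) :
    (reducedPoly fun x => φ x * ψ x).natDegree =
      (reducedPoly φ).natDegree + (reducedPoly ψ).natDegree := by
  rw [reducedPoly_eq (P := reducedPoly φ * reducedPoly ψ), natDegree_mul hφ hψ]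
  · rwa [natDegree_mul hφ hψ]
  · intro x; simp [eval_reducedPoly]

theorem natDegree_reducedPoly_pow {φ : F → F} {l : ℕ}
    (h : l * (reducedPoly φ).natDegree < Fintype.card F) :
    (reducedPoly fun x => φ x ^ l).natDegree = l * (reducedPoly φ).natDegree := by
  rw [reducedPoly_eq (P := reducedPoly φ ^ l), natDegree_pow]
  · rwa [natDegree_pow]
  · intro x; simp [eval_reducedPoly]

theorem natDegree_reducedPoly_pos {φ : F → F} (hφ : Function.Injective φ) :
    0 < (reducedPoly φ).natDegree := by
  by_contra h
  obtain ⟨c, hc⟩ := natDegree_eq_zero.mp (Nat.eq_zero_of_not_pos h)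
  refine zero_ne_one (α := F) (hφ ?_)
  rw [← eval_reducedPoly φ 0, ← eval_reducedPoly φ 1, ← hc, eval_C, eval_C]

/-- Some Frobenius twist of an injective function has large reduced degree: as long as the degree
is below `p ^ (r - 1)`, the next twist multiplies it by `p`. -/
theorem exists_le_natDegree_reducedPoly_pow {p r : ℕ} (hp : 1 < p) (hr : 0 < r)
    (hq : Fintype.card F = p ^ r) {g : F → F} (hg : Function.Injective g) :
    ∃ i, p ^ (r - 1) ≤ (reducedPoly fun x => g x ^ p ^ i).natDegree := by
  by_contra! hcon
  have hpr : p ^ r = p * p ^ (r - 1) := by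
    rw [← pow_succ', Nat.sub_add_cancel hr]
  have key : ∀ i, (reducedPoly fun x => g x ^ p ^ i).natDegree =
      p ^ i * (reducedPoly g).natDegree := by
    intro i
    induction i with
    | zero => simp
    | succ i ih =>
      have h := natDegree_reducedPoly_pow (φ := fun x => g x ^ p ^ i) (l := p) (by
        rw [hq, hpr]
        exact Nat.mul_lt_mul_of_pos_left (hcon i) (by omega))
      simp only [← pow_mul, ← pow_succ] at h
      rw [h, ih, pow_succ]; ring
  have h1 := hcon r
  have h2 := natDegree_reducedPoly_pos hg
  rw [key r] at h1
  have h3 : p ^ (r - 1) ≤ p ^ r := Nat.pow_le_pow_right (by omega) (by omega)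
  nlinarith

end ReducedPolynomial

/-! ### Functions that turn a two-term kernel into the quadratic character -/

section TwoTermKernel

open Polynomial

variable {F : Type*} [Field F] [Fintype F]

/-- Comparing the coefficients of `T ^ (k₁ - j)` in the two-term identity, read as an identity of
reduced polynomials in `T = g y`, expresses `g x ^ j` as a polynomial in `x` of degree at
most `m`. -/
theorem natDegree_reducedPoly_pow_le_of_kernel {g : F → F} (hg : Function.Bijective g)
    {m k₁ k₂ : ℕ} {α β : F} (hm : m < Fintype.card F) (hk₁ : k₁ < Fintype.card F)
    (hk₂ : k₂ < Fintype.card F) (hα : α ≠ 0)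
    (h : ∀ x y, (x - y) ^ m = α * (g x - g y) ^ k₁ + β * (g x - g y) ^ k₂)
    {j : ℕ} (hj : (k₁.choose j : F) ≠ 0) (hj' : (k₂.choose (k₁ - j) : F) = 0) :
    (reducedPoly fun x => g x ^ j).natDegree ≤ m := by
  have hjk : j ≤ k₁ := by
    by_contra hlt
    exact hj (by rw [Nat.choose_eq_zero_of_lt (by omega)]; simp)
  obtain ⟨f, -, hf⟩ := Function.bijective_iff_has_inverse.mp hg
  set Q : ℕ → F[X] := fun k => reducedPoly fun t => (-f t) ^ (m - k) with hQ
  set s := k₁ - j with hs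
  have hpoly : ∀ x, ∑ k ∈ Finset.range (m + 1), C (x ^ k * (m.choose k : F)) * Q k =
      C α * (-X + C (g x)) ^ k₁ + C β * (-X + C (g x)) ^ k₂ := by
    intro x
    have hlin : (-X + C (g x) : F[X]).natDegree ≤ 1 := by
      compute_degree
    refine eq_of_natDegree_lt_card_of_eval_eq ?_ ?_ fun t => ?_
    · have hpos : 0 < Fintype.card F := Fintype.card_pos
      refine lt_of_le_of_lt (natDegree_sum_le_of_forall_le (n := Fintype.card F - 1) _ _ fun k _ => ?_)
        (by omega)
      refine (natDegree_C_mul_le _ _).trans ?_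
      have := natDegree_reducedPoly_lt (F := F) fun t => (-f t) ^ (m - k)
      simp only [hQ]; omega
    · refine lt_of_le_of_lt (natDegree_add_le _ _) (max_lt ?_ ?_)
      · refine lt_of_le_of_lt ((natDegree_C_mul_le _ _).trans (natDegree_pow_le_of_le k₁ hlin)) ?_
        omega
      · refine lt_of_le_of_lt ((natDegree_C_mul_le _ _).trans (natDegree_pow_le_of_le k₂ hlin)) ?_
        omega
    · have h1 := h x (f t)
      rw [hf t, sub_eq_add_neg x, add_pow] at h1
      simp only [eval_finsetSum, eval_mul, eval_C, hQ, eval_reducedPoly, eval_add, eval_pow,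
        eval_neg, eval_X]
      rw [neg_add_eq_sub, ← h1]
      exact Finset.sum_congr rfl fun k _ => by ring
  have hcoeff : ∀ (c : F) (n : ℕ), ((-X + C c : F[X]) ^ n).coeff s =
      (-1) ^ s * (c ^ (n - s) * (n.choose s : F)) := by
    intro c n
    have : (-X + C c : F[X]) ^ n = ((X + C c) ^ n).comp (C (-1) * X) := by simp
    rw [this, comp_C_mul_X_coeff, coeff_X_add_C_pow, mul_comm]
  have hne : α * (-1) ^ s * (k₁.choose j : F) ≠ 0 :=
    mul_ne_zero (mul_ne_zero hα (pow_ne_zero _ (by simp))) hj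
  have hval : ∀ x, ∑ k ∈ Finset.range (m + 1), x ^ k * (m.choose k : F) * (Q k).coeff s =
      α * (-1) ^ s * (k₁.choose j : F) * g x ^ j := by
    intro x
    have h1 := congrArg (fun P => coeff P s) (hpoly x)
    simp only [finsetSum_coeff, coeff_C_mul, coeff_add, hcoeff, hj'] at h1
    rw [h1, hs, Nat.choose_symm hjk, Nat.sub_sub_self hjk]
    ring
  rw [reducedPoly_eq (P := C (α * (-1) ^ s * (k₁.choose j : F))⁻¹ *
    ∑ k ∈ Finset.range (m + 1), C ((m.choose k : F) * (Q k).coeff s) * X ^ k)]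
  rotate_left
  · refine lt_of_le_of_lt ?_ hm
    refine (natDegree_C_mul_le _ _).trans (natDegree_sum_le_of_forall_le _ _ fun k hk => ?_)
    exact (natDegree_C_mul_X_pow_le _ _).trans (by simpa [Nat.lt_succ_iff] using hk)
  · intro x
    rw [eval_mul, eval_C, inv_mul_eq_iff_eq_mul₀ hne, ← hval x]
    simp only [eval_finsetSum, eval_mul, eval_C, eval_pow, eval_X]
    exact Finset.sum_congr rfl fun k _ => by ring
  · refine (natDegree_C_mul_le _ _).trans (natDegree_sum_le_of_forall_le _ _ fun k hk => ?_)
    exact (natDegree_C_mul_X_pow_le _ _).trans (by simpa [Nat.lt_succ_iff] using hk)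

end TwoTermKernel

/-! ### Base-`p` digits and the non-existence of kernel-preserving bijections -/

section TwoTermKernelDigits

open Polynomial

variable {F : Type*} [Field F]

theorem cast_choose_mul_add {p : ℕ} [Fact p.Prime] [CharP F p] {a b c e : ℕ} (hb : b < p)
    (he : e < p) :
    (((p * a + b).choose (p * c + e) : ℕ) : F) = (b.choose e : F) * (a.choose c : F) := by
  have h := Choose.choose_modEq_choose_mod_mul_choose_div_nat (n := p * a + b) (k := p * c + e)
    (p := p)
  have hp : 0 < p := by omega
  rw [Nat.mul_add_mod, Nat.mul_add_mod, Nat.mod_eq_of_lt hb, Nat.mod_eq_of_lt he,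
    Nat.mul_add_div hp, Nat.mul_add_div hp, Nat.div_eq_of_lt hb, Nat.div_eq_of_lt he, add_zero,
    add_zero] at h
  rw [← Nat.cast_mul]
  exact (CharP.natCast_eq_natCast F p).mpr h

theorem cast_choose_ne_zero {p : ℕ} (hp : p.Prime) [CharP F p] {n k : ℕ} (hk : k ≤ n)
    (hn : n < p) : (n.choose k : F) ≠ 0 := by
  rw [Ne, CharP.cast_eq_zero_iff F p]
  intro h
  have h1 : p ∣ n.factorial := by
    rw [← Nat.choose_mul_factorial_mul_factorial hk, mul_assoc]
    exact h.mul_right _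
  exact absurd ((hp.dvd_factorial).mp h1) (by omega)

variable [Fintype F]

/-- If `D ≤ m < N * D`, where `D` is the reduced degree of `G`, then the least `l` with `m < l * D`
satisfies `l ≤ N` and `l * D ≤ 2 * m < |F|`, so `G ^ l` has reduced degree `l * D`. -/
theorem exists_lt_natDegree_reducedPoly_pow {m N : ℕ} (hq : Fintype.card F = 2 * m + 1)
    {G : F → F} (hm : m < N * (reducedPoly G).natDegree) (hD : (reducedPoly G).natDegree ≤ m) :
    ∃ l ≤ N, m < (reducedPoly fun x => G x ^ l).natDegree := by
  set D := (reducedPoly G).natDegree with hDdef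
  have hD0 : 0 < D := Nat.pos_of_ne_zero fun h => by simp [h] at hm
  have h1 : m / D * D ≤ m := Nat.div_mul_le_self m D
  have h2 : m < (m / D + 1) * D := by
    rw [mul_comm]; exact Nat.lt_mul_div_succ m hD0
  refine ⟨m / D + 1, (Nat.div_lt_iff_lt_mul hD0).mpr hm, ?_⟩
  rw [natDegree_reducedPoly_pow (by rw [← hDdef, hq, add_mul, one_mul]; omega)]
  exact h2

/-- The digits of `(p ^ r - 1) / 4` and `3 * (p ^ r - 1) / 4` in base `p = 4 * d - 1`: they alternate
between `3 * d - 1` and `d - 1`, out of phase. -/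
theorem exists_digits_of_even {p d r : ℕ} (hpd : p + 1 = 4 * d) (hr : Even r) (hr0 : 0 < r)
    {k : ℕ} (hk : 4 * k + 1 = p ^ r) :
    ∃ t u, k = p * t + (3 * d - 1) ∧ 3 * k = p * (3 * t + 2) + (d - 1) ∧
      t = p * u + (d - 1) ∧ 3 * t + 2 = p * (3 * u) + (3 * d - 1) ∧ 4 * u + 1 = p ^ (r - 2) := by
  obtain ⟨n, rfl⟩ := hr
  obtain ⟨n, rfl⟩ : ∃ n', n = n' + 1 := ⟨n - 1, by omega⟩
  have he : n + 1 + (n + 1) - 2 = 2 * n := by omega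
  have hmod : p ^ (2 * n) % 4 = 1 := by
    rw [pow_mul, Nat.pow_mod]
    have : p ^ 2 % 4 = 1 := by
      have : p % 4 = 3 := by omega
      simp [Nat.pow_mod, this]
    simp [this]
  obtain ⟨u, hu⟩ : ∃ u, 4 * u + 1 = p ^ (2 * n) := ⟨p ^ (2 * n) / 4, by omega⟩
  have hd : 1 ≤ d := by omega
  obtain ⟨d, rfl⟩ : ∃ d', d = d' + 1 := ⟨d - 1, by omega⟩
  obtain rfl : p = 4 * d + 3 := by omega
  refine ⟨(4 * d + 3) * u + d, u, ?_, ?_, ?_, ?_, ?_⟩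
  · have : (4 * d + 3) ^ (n + 1 + (n + 1)) = (4 * d + 3) ^ 2 * (4 * u + 1) := by
      rw [hu, ← pow_add]; congr 1; omega
    rw [this] at hk
    have h3 : 3 * (d + 1) - 1 = 3 * d + 2 := by omega
    rw [h3]
    nlinarith
  · have : (4 * d + 3) ^ (n + 1 + (n + 1)) = (4 * d + 3) ^ 2 * (4 * u + 1) := by
      rw [hu, ← pow_add]; congr 1; omega
    rw [this] at hk
    rw [Nat.add_sub_cancel]
    nlinarith
  · simp
  · have h3 : 3 * (d + 1) - 1 = 3 * d + 2 := by omega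
    rw [h3]; ring
  · rw [he, hu]

/-- The kernel identity that an isomorphism from the Paley graph to the Peisert graph satisfies:
both sides are the sign of the pair `x, y`, with values in `{0, 1, -1} ⊆ F`. The exponents of interest
are `m = (q - 1) / 2` and `k = (q - 1) / 4`. -/
def TwoTermKernel (g : F → F) (m k : ℕ) : Prop :=
  ∃ α β : F, α ≠ 0 ∧ ∀ x y, (x - y) ^ m = α * (g x - g y) ^ k + β * (g x - g y) ^ (3 * k)

/-- Both sides of the kernel identity are fixed by Frobenius, as the left-hand side is `0`, `1`
or `-1`; so the identity passes to Frobenius twists with the same exponents. -/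
theorem TwoTermKernel.frobenius_iterate {p : ℕ} [Fact p.Prime] [CharP F p] {g : F → F} {m k : ℕ}
    (hq : Fintype.card F = 2 * m + 1) (h : TwoTermKernel g m k) (i : ℕ) :
    TwoTermKernel (fun x => g x ^ p ^ i) m k := by
  obtain ⟨α, β, hα, h⟩ := h
  have hp : p.Prime := Fact.out
  have hodd : Odd (p ^ i) := by
    refine Odd.pow (hp.odd_of_ne_two ?_)
    rintro rfl
    have h2 : (2 : F) = 0 := by exact_mod_cast CharP.cast_eq_zero F 2
    have h3 : (Fintype.card F : F) = 0 := FiniteField.cast_card_eq_zero F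
    rw [hq] at h3
    push_cast at h3
    rw [h2, zero_mul, zero_add] at h3
    exact one_ne_zero h3
  refine ⟨α ^ p ^ i, β ^ p ^ i, pow_ne_zero _ hα, fun x y => ?_⟩
  have hfix : ((x - y) ^ m) ^ p ^ i = (x - y) ^ m := by
    rcases eq_or_ne ((x - y) ^ m) 0 with h0 | h0
    · rw [h0, zero_pow (pow_ne_zero _ hp.ne_zero)]
    · have hne : x - y ≠ 0 ∨ m = 0 := by
        by_contra! hc
        exact h0 (by rw [hc.1, zero_pow hc.2])
      rcases hne with hne | rfl
      · have h1 : (x - y) ^ m * (x - y) ^ m = 1 := by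
          rw [← pow_add, ← two_mul]
          have := FiniteField.pow_card_sub_one_eq_one (x - y) hne
          rwa [hq, Nat.add_sub_cancel] at this
        rcases mul_self_eq_one_iff.mp h1 with h1 | h1
        · simp [h1]
        · rw [h1, hodd.neg_one_pow]
      · simp
  rw [← hfix, h, add_pow_expChar_pow, mul_pow, mul_pow, ← sub_pow_expChar_pow, ← pow_mul, ← pow_mul,
    ← pow_mul, ← pow_mul, mul_comm k, mul_comm (3 * k)]

/-- For `q = p ^ r > 9` no bijection of the field with `q` elements turns the Peisert kernel into the
quadratic character. Boundedness of the reduced degrees of the powers of a Frobenius twist `G` is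
contradicted by a power of `G` if `r > 2`. If `r = 2`, it forces `G ^ p` to be affine, and then the
two kernels would have to agree as polynomials. -/
theorem not_twoTermKernel {p d r : ℕ} [Fact p.Prime] [CharP F p] (hpd : p + 1 = 4 * d)
    (hr : Even r) (hr0 : 0 < r) (hq9 : 9 < p ^ r) (hcard : Fintype.card F = p ^ r) {m k : ℕ}
    (hm : Fintype.card F = 2 * m + 1) (hk : Fintype.card F = 4 * k + 1) {g : F → F}
    (hg : Function.Bijective g) : ¬ TwoTermKernel g m k := by
  intro hker
  have hp : p.Prime := Fact.out
  have hd : 1 ≤ d := by omega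
  obtain ⟨i, hi⟩ := exists_le_natDegree_reducedPoly_pow hp.one_lt hr0 hcard hg.injective
  have hbij : ∀ i, Function.Bijective fun x => g x ^ p ^ i := fun i =>
    (bijective_iterateFrobenius F p i).comp hg
  obtain ⟨t, u, hkt, h3kt, htu, h3tu, hu⟩ := exists_digits_of_even hpd hr hr0 (hk.symm.trans hcard)
  have hk0 : 0 < k := by rw [hcard] at hk; omega
  have hchoose : ∀ l ≤ 3 * d - 1, ((k.choose l : ℕ) : F) ≠ 0 := by
    intro l hl
    have := cast_choose_mul_add (F := F) (p := p) (a := t) (b := 3 * d - 1) (c := 0) (e := l)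
      (by omega) (by omega)
    rw [← hkt, mul_zero, zero_add, Nat.choose_zero_right, Nat.cast_one, mul_one] at this
    rw [this]
    exact cast_choose_ne_zero hp hl (by omega)
  have hdeg : ∀ (i j : ℕ), ((k.choose j : ℕ) : F) ≠ 0 → (((3 * k).choose (k - j) : ℕ) : F) = 0 →
      (reducedPoly fun x => (g x ^ p ^ i) ^ j).natDegree ≤ m := by
    intro i j h1 h2
    obtain ⟨α, β, hα, h⟩ := hker.frobenius_iterate (p := p) hm i
    exact natDegree_reducedPoly_pow_le_of_kernel (hbij i) (by omega) (by omega) (by omega) hα h h1 h2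
  have hpow : p ^ r = p * p ^ (r - 1) := by rw [← pow_succ', Nat.sub_add_cancel hr0]
  rcases eq_or_ne r 2 with rfl | hr2
  · -- `q = p ^ 2`: here the powers up to `2 * d - 1` and the mixed power `2 * d - 1 + p`, that is
    -- `G ^ (2 * d - 1) * G ^ p`, are known to have reduced degree at most `m`.
    -- The digit `d - 1` of `k` is nonzero only for `p > 3`; this is where `q = 9` drops out.
    have hp7 : 2 ≤ d := by
      by_contra hlt
      have : p = 3 := by omega
      subst this
      norm_num at hq9
    obtain rfl : u = 0 := by simpa using hu
    have hmh : m = (2 * d - 1) * (p + 1) := by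
      rw [hcard] at hm
      obtain ⟨d, rfl⟩ : ∃ d', d = d' + 1 := ⟨d - 1, by omega⟩
      obtain rfl : p = 4 * d + 3 := by omega
      have : 2 * (d + 1) - 1 = 2 * d + 1 := by omega
      rw [this]
      nlinarith
    have hlow : ∀ (i : ℕ), ∀ l ≤ 2 * d - 1,
        (reducedPoly fun x => (g x ^ p ^ i) ^ l).natDegree ≤ m := by
      intro i l hl
      refine hdeg i l (hchoose l (by omega)) ?_
      have : k - l = p * t + (3 * d - 1 - l) := by omega
      rw [this, h3kt, cast_choose_mul_add (by omega) (by omega),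
        Nat.choose_eq_zero_of_lt (show d - 1 < 3 * d - 1 - l by omega)]
      simp
    have hle : ∀ i, (reducedPoly fun x => g x ^ p ^ i).natDegree ≤ p + 1 := by
      intro i
      by_contra! hlt
      obtain ⟨l, hl, hl'⟩ := exists_lt_natDegree_reducedPoly_pow hm (N := 2 * d - 1)
        (G := fun x => g x ^ p ^ i)
        (by rw [hmh]; exact Nat.mul_lt_mul_of_pos_left hlt (by omega))
        (by simpa using hlow i 1 (by omega))
      exact absurd (hlow i l hl) (by omega)
    have hmix : (reducedPoly fun x => (g x ^ p ^ i) ^ (2 * d - 1 + p)).natDegree ≤ m := by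
      refine hdeg i _ ?_ ?_
      · have := cast_choose_mul_add (F := F) (p := p) (a := t) (b := 3 * d - 1) (c := 1)
          (e := 2 * d - 1) (by omega) (by omega)
        rw [← hkt, mul_one, add_comm p] at this
        rw [this, htu, mul_zero, zero_add]
        exact mul_ne_zero (cast_choose_ne_zero hp (by omega) (by omega))
          (cast_choose_ne_zero hp (by omega) (by omega))
      · have : k - (2 * d - 1 + p) = p * (t - 1) + d := by
          obtain ⟨t', rfl⟩ : ∃ t', t = t' + 1 := ⟨t - 1, by omega⟩
          rw [Nat.add_sub_cancel]
          rw [mul_add] at hkt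
          omega
        rw [this, h3kt, cast_choose_mul_add (by omega) (by omega),
          Nat.choose_eq_zero_of_lt (show d - 1 < d by omega)]
        simp
    set D := (reducedPoly fun x => g x ^ p ^ i).natDegree with hD
    set E := (reducedPoly fun x => g x ^ p ^ (i + 1)).natDegree with hE
    have hDle : D ≤ p + 1 := hle i
    have hEle : E ≤ p + 1 := hle (i + 1)
    have hE0 : 0 < E := natDegree_reducedPoly_pos (hbij (i + 1)).injective
    have hpi : p ≤ D := by simpa using hi
    have hDh : (2 * d - 1) * D ≤ m := by
      rw [hmh]; exact Nat.mul_le_mul_left _ hDle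
    have hp1m : p + 1 ≤ m := by
      rw [hmh]; exact Nat.le_mul_of_pos_left _ (by omega)
    have hGpow := natDegree_reducedPoly_pow (φ := fun x => g x ^ p ^ i) (l := 2 * d - 1)
      (by rw [← hD]; omega)
    rw [← hD] at hGpow
    have hsum : (2 * d - 1) * D + E ≤ m := by
      have h1 := natDegree_reducedPoly_mul (φ := fun x => (g x ^ p ^ i) ^ (2 * d - 1))
        (ψ := fun x => g x ^ p ^ (i + 1))
        (by
          intro h0
          rw [h0, natDegree_zero] at hGpow
          have : 0 < (2 * d - 1) * D := Nat.mul_pos (by omega) (by have := hp.pos; omega)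
          omega)
        (by intro h0; rw [hE, h0, natDegree_zero] at hE0; omega)
        (by rw [hGpow, ← hE]; omega)
      rw [hGpow] at h1
      rw [hE, ← h1]
      refine le_of_eq_of_le ?_ hmix
      congr 2
      funext x
      rw [pow_add (g x ^ p ^ i), pow_succ p, pow_mul]
    have hDp : D = p := by
      by_contra hne
      have : D = p + 1 := by omega
      rw [this] at hsum
      omega
    -- `G ^ p` has degree `E < p`, so its `p`-th power `G ^ (p ^ 2) = G` has degree `p * E`.
    have hE1 : p * E = p := by
      have hEh : E ≤ 2 * d - 1 := by
        rw [hDp, hmh, mul_add] at hsum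
        omega
      have h1 := natDegree_reducedPoly_pow (φ := fun x => g x ^ p ^ (i + 1)) (l := p) (by
        rw [← hE, hcard, hpow]
        refine Nat.mul_lt_mul_of_pos_left ?_ hp.pos
        simpa using by omega)
      have h2 : (fun x => (g x ^ p ^ (i + 1)) ^ p) = fun x => g x ^ p ^ i := by
        funext x
        have h3 := FiniteField.pow_card (g x ^ p ^ i)
        rw [hcard] at h3
        rw [← pow_mul (g x), ← pow_succ p, add_assoc, pow_add p, pow_mul (g x), h3]
      rw [h2, ← hE, ← hD, hDp] at h1
      exact h1.symm
    have hE1' : E = 1 := Nat.eq_of_mul_eq_mul_left hp.pos (by rw [hE1, mul_one])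
    obtain ⟨a, ha, b, hab⟩ := natDegree_eq_one.mp hE1'
    have haff : ∀ x, g x ^ p ^ (i + 1) = a * x + b := by
      intro x
      rw [← eval_reducedPoly (fun x => g x ^ p ^ (i + 1)) x, ← hab]
      simp
    obtain ⟨α, β, hα, h⟩ := hker.frobenius_iterate (p := p) hm (i + 1)
    simp only [haff] at h
    have hpoly : (X ^ m : F[X]) = C (α * a ^ k) * X ^ k + C (β * a ^ (3 * k)) * X ^ (3 * k) := by
      refine eq_of_natDegree_lt_card_of_eval_eq (by rw [natDegree_X_pow]; omega) ?_ fun x => ?_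
      · refine lt_of_le_of_lt (natDegree_add_le _ _) (max_lt ?_ ?_)
        · exact lt_of_le_of_lt (natDegree_C_mul_X_pow_le _ _) (by omega)
        · exact lt_of_le_of_lt (natDegree_C_mul_X_pow_le _ _) (by omega)
      · have := h x 0
        simp only [sub_zero, mul_zero, zero_add, add_sub_cancel_right, mul_pow] at this
        simp only [eval_pow, eval_X, eval_add, eval_mul, eval_C, this]
        ring
    have hcoeff := congrArg (fun P => coeff P k) hpoly
    simp only [coeff_X_pow, coeff_add, coeff_C_mul, if_true] at hcoeff
    rw [if_neg (by omega), if_neg (by omega), mul_one, mul_zero, add_zero] at hcoeff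
    exact mul_ne_zero hα (pow_ne_zero _ ha) hcoeff.symm
  · -- `r ≥ 4`: the powers up to `2 * d` are controlled, one more than the digit `2 * d - 1` of `m`
    -- allows for a function of reduced degree at least `p ^ (r - 1)`.
    have hr4 : 0 < r - 2 := by
      obtain ⟨n, rfl⟩ := hr
      omega
    have hr2e : Even (r - 2) := by
      obtain ⟨n, rfl⟩ := hr
      exact ⟨n - 1, by omega⟩
    obtain ⟨v, w, huv, h3uv, -, -, -⟩ := exists_digits_of_even hpd hr2e hr4 hu
    have hlow : ∀ l ≤ 2 * d, (reducedPoly fun x => (g x ^ p ^ i) ^ l).natDegree ≤ m := by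
      intro l hl
      refine hdeg i l (hchoose l (by omega)) ?_
      have : k - l = p * t + (3 * d - 1 - l) := by omega
      rw [this, h3kt, cast_choose_mul_add (by omega) (by omega), h3tu]
      nth_rewrite 1 [htu]
      -- The digits at `p ^ 2` are `d - 1` and `3 * d - 1`, which makes the coefficient vanish.
      rw [cast_choose_mul_add (by omega) (by omega), h3uv]
      nth_rewrite 1 [huv]
      rw [cast_choose_mul_add (by omega) (by omega),
        Nat.choose_eq_zero_of_lt (show d - 1 < 3 * d - 1 by omega)]
      simp
    have hbig : m < 2 * d * (reducedPoly fun x => g x ^ p ^ i).natDegree := by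
      refine lt_of_lt_of_le ?_ (Nat.mul_le_mul_left _ hi)
      have h1 : 2 * m + 1 = p * p ^ (r - 1) := by rw [← hm, hcard, hpow]
      have h2 : (p + 1) * p ^ (r - 1) = 4 * d * p ^ (r - 1) := by rw [hpd]
      nlinarith
    obtain ⟨l, hl, hl'⟩ := exists_lt_natDegree_reducedPoly_pow hm (N := 2 * d)
      (G := fun x => g x ^ p ^ i) hbig (by simpa using hlow 1 (by omega))
    exact absurd (hlow l hl) (by omega)

end TwoTermKernelDigits

/-! ### The Paley and Peisert graphs as sign graphs -/

section PaleySign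

variable {F : Type*} [Field F] [Fintype F]

theorem ringChar_ne_two_of_card_mod_four (hF : Fintype.card F % 4 = 1) : ringChar F ≠ 2 := by
  intro h
  have := FiniteField.even_card_iff_char_two.mp h
  omega

variable [DecidableEq F]

theorem paleyGraph_adj_iff (hF : Fintype.card F % 4 = 1) (x y : F) :
    (paleyGraph F).Adj x y ↔ quadraticChar F (x - y) = 1 := by
  have hneg : IsSquare (-1 : F) := FiniteField.isSquare_neg_one_iff.mpr (by omega)
  rw [paleyGraph, SimpleGraph.fromRel_adj]
  rcases eq_or_ne x y with rfl | hxy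
  · simp
  · have hsymm : IsSquare (y - x) → IsSquare (x - y) := fun h => by
      simpa using hneg.mul h
    rw [quadraticChar_one_iff_isSquare (sub_ne_zero.mpr hxy)]
    exact ⟨fun h => h.2.elim id hsymm, fun h => ⟨hxy, Or.inl h⟩⟩

theorem paleyGraph_isSRGWith (hF : Fintype.card F % 4 = 1) [DecidableRel (paleyGraph F).Adj] :
    (paleyGraph F).IsSRGWith (Fintype.card F) ((Fintype.card F - 1) / 2)
      ((Fintype.card F - 5) / 4) ((Fintype.card F - 1) / 4) := by
  refine isSRGWith_of_sign (quadraticChar_zero) (fun z hz => quadraticChar_dichotomy hz)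
    (paleyGraph_adj_iff hF) (quadraticChar_sum_zero (ringChar_ne_two_of_card_mod_four hF))
    fun a ha => ?_
  refine (Fintype.sum_equiv (Equiv.mulLeft₀ a ha) _ _ fun z => ?_).symm
  have h : a * z + a = a * (z + 1) := by ring
  simp only [Equiv.mulLeft₀_apply]
  rw [h, map_mul, map_mul, mul_mul_mul_comm, ← sq, quadraticChar_sq_one ha, one_mul]

end PaleySign

section PeisertSign

variable {F : Type*} [Field F]

open Classical in
/-- The sign function of the Peisert graph with primitive root `ω`: `0` at `0`, and `1` or `-1` at
`ω ^ j` according to whether `j` is congruent to `0` or `1` modulo `4` or not. -/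
noncomputable def peisertSign (ω z : F) : ℤ :=
  if z = 0 then 0 else if ∃ j : ℕ, (j % 4 = 0 ∨ j % 4 = 1) ∧ z = ω ^ j then 1 else -1

theorem peisertSign_zero (ω : F) : peisertSign ω 0 = 0 := by simp [peisertSign]

theorem peisertSign_dichotomy (ω : F) {z : F} (hz : z ≠ 0) :
    peisertSign ω z = 1 ∨ peisertSign ω z = -1 := by
  rw [peisertSign, if_neg hz]
  split_ifs <;> simp

theorem peisertSign_pow {ω : F} {n : ℕ} (hω : IsPrimitiveRoot ω n) (hn : n ≠ 0) (h4 : 4 ∣ n)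
    (j : ℕ) : peisertSign ω (ω ^ j) = if j % 4 = 0 ∨ j % 4 = 1 then 1 else -1 := by
  have hω0 : ω ≠ 0 := hω.ne_zero hn
  rw [peisertSign, if_neg (pow_ne_zero _ hω0)]
  congr 1
  refine propext ⟨?_, fun h => ⟨j, h, rfl⟩⟩
  rintro ⟨i, hi, hij⟩
  have h : j ≡ i [MOD n] := by
    rw [← pow_mod_orderOf ω j, ← pow_mod_orderOf ω i, ← hω.eq_orderOf] at hij
    exact hω.pow_inj (Nat.mod_lt _ (by omega)) (Nat.mod_lt _ (by omega)) hij
  have h' : j % 4 = i % 4 := h.of_dvd h4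
  rwa [h']

variable [Fintype F]

theorem exists_eq_pow_of_isPrimitiveRoot {ω : F} (hω : IsPrimitiveRoot ω (Fintype.card F - 1))
    {z : F} (hz : z ≠ 0) : ∃ j : ℕ, z = ω ^ j := by
  have : NeZero (Fintype.card F - 1) := ⟨by
    have : 1 < Fintype.card F := Fintype.one_lt_card
    omega⟩
  obtain ⟨j, -, hj⟩ := hω.eq_pow_of_pow_eq_one (FiniteField.pow_card_sub_one_eq_one z hz)
  exact ⟨j, hj.symm⟩

theorem peisertSign_omega_sq_mul {ω : F} (hω : IsPrimitiveRoot ω (Fintype.card F - 1))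
    (h4 : 4 ∣ Fintype.card F - 1) (z : F) : peisertSign ω (ω ^ 2 * z) = -peisertSign ω z := by
  have hn : Fintype.card F - 1 ≠ 0 := by
    have : 1 < Fintype.card F := Fintype.one_lt_card
    omega
  rcases eq_or_ne z 0 with rfl | hz
  · simp [peisertSign_zero]
  obtain ⟨j, rfl⟩ := exists_eq_pow_of_isPrimitiveRoot hω hz
  rw [← pow_add, peisertSign_pow hω hn h4, peisertSign_pow hω hn h4]
  split_ifs <;> omega

/-- As `p ≡ 3 (mod 4)`, the map `ω ^ j ↦ ω ^ (1 + j * p)` interchanges the exponent classes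
`0` and `1` modulo `4`, and likewise `2` and `3`. -/
theorem peisertSign_omega_mul_pow {ω : F} (hω : IsPrimitiveRoot ω (Fintype.card F - 1))
    (h4 : 4 ∣ Fintype.card F - 1) {p : ℕ} (hp : p % 4 = 3) (z : F) :
    peisertSign ω (ω * z ^ p) = peisertSign ω z := by
  have hn : Fintype.card F - 1 ≠ 0 := by
    have : 1 < Fintype.card F := Fintype.one_lt_card
    omega
  rcases eq_or_ne z 0 with rfl | hz
  · rw [zero_pow (by omega), mul_zero]
  obtain ⟨j, rfl⟩ := exists_eq_pow_of_isPrimitiveRoot hω hz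
  rw [← pow_mul, ← pow_succ', peisertSign_pow hω hn h4, peisertSign_pow hω hn h4]
  have h : (j * p + 1) % 4 = (j * 3 + 1) % 4 := by
    rw [Nat.add_mod, Nat.mul_mod, hp]
    simp [Nat.add_mod, Nat.mul_mod]
  rw [h]
  split_ifs <;> omega

theorem peisertGraph_adj_iff {ω : F} (hω : IsPrimitiveRoot ω (Fintype.card F - 1))
    (h8 : 8 ∣ Fintype.card F - 1) (x y : F) :
    (peisertGraph ω).Adj x y ↔ peisertSign ω (x - y) = 1 := by
  have hn : Fintype.card F - 1 ≠ 0 := by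
    have : 1 < Fintype.card F := Fintype.one_lt_card
    omega
  obtain ⟨c, hc⟩ := h8
  -- `-1` is the fourth power `ω ^ ((q - 1) / 2)`.
  have hneg : ω ^ (4 * c) = -1 := by
    have h1 : ω ^ (4 * c) * ω ^ (4 * c) = 1 := by
      rw [← pow_add, ← two_mul, ← mul_assoc]
      exact hc ▸ hω.pow_eq_one
    refine (mul_self_eq_one_iff.mp h1).resolve_left fun h => ?_
    have := Nat.le_of_dvd (by omega) (hω.dvd_of_pow_eq_one _ h)
    omega
  have hrel : ∀ z : F, z ≠ 0 → (peisertSign ω z = 1 ↔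
      ∃ j : ℕ, (j % 4 = 0 ∨ j % 4 = 1) ∧ z = ω ^ j) := by
    intro z hz
    rw [peisertSign, if_neg hz]
    split_ifs with h
    · simpa using h
    · simpa using h
  rw [peisertGraph, SimpleGraph.fromRel_adj]
  rcases eq_or_ne x y with rfl | hxy
  · simp [peisertSign_zero]
  · rw [hrel _ (sub_ne_zero.mpr hxy)]
    refine ⟨fun h => h.2.elim id ?_, fun h => ⟨hxy, Or.inl h⟩⟩
    rintro ⟨j, hj, hyx⟩
    refine ⟨4 * c + j, by omega, ?_⟩
    rw [pow_add, hneg, ← hyx]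
    ring

/-- The shifts `a` and `ω ^ 2 * a` have equal autocorrelation, since multiplication by `ω ^ 2` changes
all signs; the shifts `1` and `ω` do, since `z ↦ ω * z ^ p` is additive, preserves all signs and
sends `1` to `ω`. -/
theorem peisertGraph_isSRGWith [DecidableEq F] {p : ℕ} [Fact p.Prime] [CharP F p]
    (hp4 : p % 4 = 3) {ω : F} (hω : IsPrimitiveRoot ω (Fintype.card F - 1))
    (h8 : 8 ∣ Fintype.card F - 1) [DecidableRel (peisertGraph ω).Adj] :
    (peisertGraph ω).IsSRGWith (Fintype.card F) ((Fintype.card F - 1) / 2)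
      ((Fintype.card F - 5) / 4) ((Fintype.card F - 1) / 4) := by
  have h4 : 4 ∣ Fintype.card F - 1 := (by norm_num : 4 ∣ 8).trans h8
  have hω0 : ω ≠ 0 := hω.ne_zero (by
    have : 1 < Fintype.card F := Fintype.one_lt_card
    omega)
  have hsq0 : ω ^ 2 ≠ 0 := pow_ne_zero _ hω0
  have hsum : ∑ z, peisertSign ω z = 0 := by
    have h := Fintype.sum_equiv (Equiv.mulLeft₀ (ω ^ 2) hsq0) (fun z => -peisertSign ω z)
      (peisertSign ω) fun z => (peisertSign_omega_sq_mul hω h4 z).symm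
    rw [Finset.sum_neg_distrib] at h
    linarith
  have hT2 : ∀ a, ∑ z, peisertSign ω z * peisertSign ω (z + ω ^ 2 * a) =
      ∑ z, peisertSign ω z * peisertSign ω (z + a) := by
    intro a
    refine (Fintype.sum_equiv (Equiv.mulLeft₀ (ω ^ 2) hsq0) _ _ fun z => ?_).symm
    simp only [Equiv.mulLeft₀_apply]
    rw [← mul_add, peisertSign_omega_sq_mul hω h4, peisertSign_omega_sq_mul hω h4, neg_mul_neg]
  have hT1 : ∑ z, peisertSign ω z * peisertSign ω (z + ω) =
      ∑ z, peisertSign ω z * peisertSign ω (z + 1) := by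
    refine (Fintype.sum_equiv ((Equiv.ofBijective _ (bijective_frobenius F p)).trans
      (Equiv.mulLeft₀ ω hω0)) _ _ fun z => ?_).symm
    simp only [Equiv.trans_apply, Equiv.ofBijective_apply, Equiv.mulLeft₀_apply, frobenius_def]
    have h : ω * z ^ p + ω = ω * (z + 1) ^ p := by
      rw [add_pow_expChar, one_pow]; ring
    rw [h, peisertSign_omega_mul_pow hω h4 hp4, peisertSign_omega_mul_pow hω h4 hp4]
  refine isSRGWith_of_sign (peisertSign_zero ω) (fun z hz => peisertSign_dichotomy ω hz)
    (peisertGraph_adj_iff hω h8) hsum fun a ha => ?_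
  obtain ⟨j, rfl⟩ := exists_eq_pow_of_isPrimitiveRoot hω ha
  induction j using Nat.twoStepInduction with
  | zero => simp
  | one => simpa using hT1
  | more j ih _ =>
    rw [pow_add, mul_comm, hT2]
    exact ih (pow_ne_zero _ hω0)

/-- With `i = ω ^ k` a square root of `-1`, the sign function is
`(1 - i) / 2 * z ^ k + (1 + i) / 2 * z ^ (3 * k)`. -/
theorem exists_peisertSign_eq_two_term {ω : F} {k : ℕ} (hk : Fintype.card F = 4 * k + 1)
    (hω : IsPrimitiveRoot ω (Fintype.card F - 1)) :
    ∃ α β : F, α ≠ 0 ∧ ∀ z, (peisertSign ω z : F) = α * z ^ k + β * z ^ (3 * k) := by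
  have hk' : Fintype.card F - 1 = 4 * k := by omega
  have hk0 : 0 < k := by
    have : 1 < Fintype.card F := Fintype.one_lt_card
    omega
  have hone : (ω ^ k) ^ 2 ≠ 1 := by
    rw [← pow_mul]
    intro h
    have := Nat.le_of_dvd (by omega) (hω.dvd_of_pow_eq_one _ h)
    omega
  have hi : (ω ^ k) ^ 2 = -1 := by
    have h1 : (ω ^ k) ^ 2 * (ω ^ k) ^ 2 = 1 := by
      rw [← pow_add, ← pow_mul, mul_comm k, ← hk']
      exact hω.pow_eq_one
    exact (mul_self_eq_one_iff.mp h1).resolve_left hone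
  have h2 : (2 : F) ≠ 0 := by
    intro h
    refine hone ?_
    rw [hi]
    linear_combination -h
  set i := ω ^ k with hidef
  refine ⟨(1 - i) / 2, (1 + i) / 2, ?_, fun z => ?_⟩
  · refine div_ne_zero (fun h => hone ?_) h2
    rw [← sub_eq_zero.mp h, one_pow]
  rcases eq_or_ne z 0 with rfl | hz
  · rw [peisertSign_zero, zero_pow hk0.ne', zero_pow (by omega)]; simp
  obtain ⟨j, rfl⟩ := exists_eq_pow_of_isPrimitiveRoot hω hz
  have hi4 : i ^ 4 = 1 := by linear_combination (i ^ 2 - 1) * hi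
  have hjk : (ω ^ j) ^ k = i ^ (j % 4) := by
    rw [← pow_mul, mul_comm, pow_mul, ← hidef]
    conv_lhs => rw [← Nat.div_add_mod j 4, pow_add, pow_mul, hi4, one_pow, one_mul]
  rw [mul_comm 3 k, pow_mul (ω ^ j), hjk,
    peisertSign_pow hω (by omega) ⟨k, hk'⟩]
  have hj4 : j % 4 < 4 := Nat.mod_lt _ (by norm_num)
  field_simp
  interval_cases j % 4 <;> norm_num <;> grind

end PeisertSign

/-! ### Non-isomorphism and cospectrality -/

section Comparison

variable {F : Type*} [Field F] [Fintype F]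

/-- For `q > 9` an isomorphism would be a bijection that transports the Peisert kernel to the
quadratic character. -/
theorem isEmpty_paleyGraph_iso_peisertGraph {p r : ℕ} [Fact p.Prime] [CharP F p]
    (hp4 : p % 4 = 3) (hr : Even r) (hr0 : 0 < r) (hcard : Fintype.card F = p ^ r)
    (h8 : 8 ∣ Fintype.card F - 1) (hq9 : 9 < p ^ r) {ω : F}
    (hω : IsPrimitiveRoot ω (Fintype.card F - 1)) :
    IsEmpty (paleyGraph F ≃g peisertGraph ω) := by
  classical
  refine ⟨fun e => ?_⟩
  have hF : Fintype.card F % 4 = 1 := by omega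
  obtain ⟨α, β, hα, hsign⟩ := exists_peisertSign_eq_two_term (k := Fintype.card F / 4) (by omega) hω
  refine not_twoTermKernel (p := p) (d := (p + 1) / 4) (m := Fintype.card F / 2)
    (k := Fintype.card F / 4) (g := e) (by omega) hr hr0 hq9 hcard (by omega) (by omega)
    e.bijective ⟨α, β, hα, fun x y => ?_⟩
  rw [← hsign, ← quadraticChar_eq_pow_of_char_ne_two' (ringChar_ne_two_of_card_mod_four hF)]
  congr 1
  rcases eq_or_ne x y with rfl | hxy
  · simp [peisertSign_zero]
  have h := (paleyGraph_adj_iff hF x y).symm.trans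
    (e.map_rel_iff.symm.trans (peisertGraph_adj_iff hω h8 (e x) (e y)))
  rcases quadraticChar_dichotomy (sub_ne_zero.mpr hxy) with h1 | h1 <;>
    rcases peisertSign_dichotomy ω (sub_ne_zero.mpr (e.injective.ne hxy)) with h2 | h2
  · rw [h1, h2]
  · rw [h1, h2] at h; norm_num at h
  · rw [h1, h2] at h; norm_num at h
  · rw [h1, h2]

theorem paleyGraph_peisertGraph [DecidableEq F] {p r : ℕ} (hp : p.Prime) (hp4 : p % 4 = 3)
    (hr0 : 0 < r) (hr : Even r) (ω : F) [DecidableRel (paleyGraph F).Adj]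
    [DecidableRel (peisertGraph ω).Adj] (hcard : Fintype.card F = p ^ r)
    (hω : IsPrimitiveRoot ω (p ^ r - 1)) :
    (paleyGraph F).IsSRGWith (p ^ r) ((p ^ r - 1) / 2) ((p ^ r - 5) / 4) ((p ^ r - 1) / 4) ∧
      (peisertGraph ω).IsSRGWith
        (p ^ r) ((p ^ r - 1) / 2) ((p ^ r - 5) / 4) ((p ^ r - 1) / 4) ∧
      Cospectral (paleyGraph F) (peisertGraph ω) ∧
      (9 < p ^ r → IsEmpty (paleyGraph F ≃g peisertGraph ω)) := by
  have : Fact p.Prime := ⟨hp⟩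
  have : CharP F p := charP_of_card_eq_prime_pow hcard
  have h8 : 8 ∣ Fintype.card F - 1 := by
    have h : p ^ r % 8 = 1 := by
      obtain ⟨n, rfl⟩ := hr
      have h2 : p ^ 2 % 8 = 1 := by
        have : p % 8 = 3 ∨ p % 8 = 7 := by omega
        rcases this with h | h <;> simp [Nat.pow_mod, h]
      rw [← two_mul, pow_mul, Nat.pow_mod, h2]
      simp
    rw [hcard]; omega
  have hone : 1 < Fintype.card F := Fintype.one_lt_card
  rw [← hcard] at hω
  have h1 := paleyGraph_isSRGWith (F := F) (by omega)
  have h2 := peisertGraph_isSRGWith hp4 hω h8 (p := p)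
  refine ⟨hcard ▸ h1, hcard ▸ h2, h1.cospectral h2, fun hq9 => ?_⟩
  exact isEmpty_paleyGraph_iso_peisertGraph hp4 hr hr0 hcard h8 hq9 hω

end Comparison

theorem corollary2 :
    (∀ (p r : ℕ), p.Prime → p % 4 = 3 → 0 < r → Even r →
      ∀ (F : Type*) [Field F] [Fintype F] [DecidableEq F] (ω : F)
        [DecidableRel (paleyGraph F).Adj] [DecidableRel (peisertGraph ω).Adj],
        Fintype.card F = p ^ r → IsPrimitiveRoot ω (p ^ r - 1) →
          (paleyGraph F).IsSRGWith (p ^ r) ((p ^ r - 1) / 2) ((p ^ r - 5) / 4) ((p ^ r - 1) / 4) ∧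
          (peisertGraph ω).IsSRGWith
            (p ^ r) ((p ^ r - 1) / 2) ((p ^ r - 5) / 4) ((p ^ r - 1) / 4) ∧
          Cospectral (paleyGraph F) (peisertGraph ω) ∧
          (9 < p ^ r → IsEmpty (paleyGraph F ≃g peisertGraph ω))) ∧
    {q : ℕ | ∃ p r : ℕ, p.Prime ∧ p % 4 = 3 ∧ 0 < r ∧ Even r ∧ q = p ^ r ∧
      ∃ (F : Type) (_ : Field F) (_ : Fintype F) (ω : F),
        Fintype.card F = q ∧ IsPrimitiveRoot ω (q - 1) ∧
          Cospectral (paleyGraph F) (peisertGraph ω) ∧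
          IsEmpty (paleyGraph F ≃g peisertGraph ω)}.Infinite := by
  classical
  refine ⟨fun p r hp hp4 hr0 hr F _ _ _ ω _ _ hcard hω =>
    paleyGraph_peisertGraph hp hp4 hr0 hr ω hcard hω, ?_⟩
  have hinj : Function.Injective fun n : ℕ => 7 ^ (2 * (n + 1)) := fun a b h => by
    have := Nat.pow_right_injective (le_refl 2 |>.trans (by norm_num : 2 ≤ 7)) h
    omega
  refine Set.infinite_of_injective_forall_mem hinj fun n => ?_
  have h7 : Nat.Prime 7 := by norm_num
  have : Fact (Nat.Prime 7) := ⟨h7⟩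
  have hev : Even (2 * (n + 1)) := even_two_mul _
  let F := GaloisField 7 (2 * (n + 1))
  let _ : Fintype F := Fintype.ofFinite F
  have hcard : Fintype.card F = 7 ^ (2 * (n + 1)) := by
    rw [← Nat.card_eq_fintype_card]
    exact GaloisField.card 7 _ (by omega)
  obtain ⟨g, hg⟩ := IsCyclic.exists_generator (α := Fˣ)
  have hω : IsPrimitiveRoot (g : F) (7 ^ (2 * (n + 1)) - 1) := by
    rw [IsPrimitiveRoot.coe_units_iff, ← hcard, ← Fintype.card_units, ← Nat.card_eq_fintype_card,
      ← orderOf_eq_card_of_forall_mem_zpowers hg]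
    exact IsPrimitiveRoot.orderOf g
  have hmain := paleyGraph_peisertGraph h7 (by norm_num) (by omega) hev (g : F) hcard hω
  have hq9 : 9 < 7 ^ (2 * (n + 1)) := by
    calc 9 < 7 ^ 2 := by norm_num
      _ ≤ 7 ^ (2 * (n + 1)) := Nat.pow_le_pow_right (by norm_num) (by omega)
  exact ⟨7, 2 * (n + 1), h7, by norm_num, by omega, hev, rfl, F, inferInstance, inferInstance, g,
    hcard, hω, hmain.2.2.1, hmain.2.2.2 hq9⟩
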